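/- Let $\mathbb Z'=\mathbb Z+\tfrac12$, let $0<\xi<1$, and let $z,z'\in\mathbb C$ satisfy one of the following: (principal series) $z,z'$ are non-real and complex conjugate to each other; or (complementary series) $z,z'$ are real and lie in a common open interval $(m,m+1)$ with $m\in\mathbb Z$. For $a\in\mathbb Z'$ put $$\psi_a(x)=\left(\frac{\Gamma(x+z+\frac12)\Gamma(x+z'+\frac12)}{\Gamma(z-a+\frac12)\Gamma(z'-a+\frac12)}\right)^{1/2}\xi^{\frac12(x+a)}(1-\xi)^{\frac12(z+z')-a}\;\frac{F\!\left(-z+a+\frac12,-z'+a+\frac12;x+a+1;\frac{\xi}{\xi-1}\right)}{\Gamma(x+a+1)},$$ where $F(A,B;C;w)$ is the Gauss hypergeometric function, analytically continued from $|w|<1$ to the half-plane $\operatorname{Re}w<\tfrac12$ (which contains the negative semi-axis), and $F(A,B;C;w)/\Gamma(C)$ is understood for all $C\in\mathbb C$, including $C=0,-1,-2,\dots$, as the continuation of $\sum_{n\ge0}\frac{(A)_n(B)_n}{\Gamma(C+n)\,n!}w^n$. For $x\in\mathbb Z'$ the number under the square root is positive and the positive root is taken; the same expression, with the principal branch of the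 root, is used for complex $x$ close to $\mathbb Z'$. Define the kernel $$K(x,y)=\sum_{a\in\{\frac12,\frac32,\frac52,\dots\}}\psi_a(x)\psi_a(y),\qquad x,y\in\mathbb Z'.$$ Then this series converges absolutely for all $x,y\in\mathbb Z'$, and for $x\ne y$ in $\mathbb Z'$ $$K(x,y)=\frac{\sqrt{zz'\xi}}{1-\xi}\;\frac{\psi_{-\frac12}(x)\psi_{\frac12}(y)-\psi_{\frac12}(x)\psi_{-\frac12}(y)}{x-y},$$ where $zz'\xi>0$ and the positive root is taken. On the diagonal the same formula holds in the following sense. There is an open set $U\subset\mathbb C$ containing $\mathbb Z'$ on which $\psi_{\frac12}$ and $\psi_{-\frac12}$ are analytic, and the quotient $\bigl(\psi_{-\frac12}(x)\psi_{\frac12}(y)-\psi_{\frac12}(x)\psi_{-\frac12}(y)\bigr)/(x-y)$, defined for $x\neq y$ in $U$, extends to an analytic function $Q(x,y)$ on $U\times U$; for every $x\in\mathbb Z'$ one has $$K(x,x)=\frac{\sqrt{zz'\xi}}{1-\xi}\,Q(x,x)=\frac{\sqrt{zz'\xi}}{1-\xi}\Bigl(\psi_{-\frac12}'(x)\psi_{\frac12}(x)-\psi_{\frac12}'(x)\psi_{-\frac12}(x)\Bigr).$$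 -/

import Mathlib

open Set Filter Topology

noncomputable section

namespace DiscreteHypergeometric

/-- The lattice `ℤ' = ℤ + 1/2` of proper half-integers, viewed inside `ℂ`. -/
def halfIntegers : Set ℂ :=
  Set.range fun k : ℤ => (k : ℂ) + 1 / 2

/-- Principal series: `z, z'` are not real and are conjugate to each other. -/
def PrincipalSeries (z z' : ℂ) : Prop :=
  z.im ≠ 0 ∧ z' = (starRingEnd ℂ) z

/-- Complementary series: `z, z'` are real and lie in the same open interval `(m, m + 1)`
with `m` an integer. -/
def ComplementarySeries (z z' : ℂ) : Prop :=
  z.im = 0 ∧ z'.im = 0 ∧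
    ∃ m : ℤ, z.re ∈ Ioo (m : ℝ) (m + 1) ∧ z'.re ∈ Ioo (m : ℝ) (m + 1)

/-- `f` is an analytic continuation of the regularized Gauss hypergeometric series
`F(A, B; C; w) / Γ(C) = ∑ₙ (A)ₙ (B)ₙ / (Γ(C + n) n!) wⁿ` from a neighbourhood of `w = 0` to the
half-plane `Re w < 1/2`. This half-plane is connected and contains `0` and the negative semi-axis,
so that `f` is determined on it. -/
def IsGaussContinuation (A B C : ℂ) (f : ℂ → ℂ) : Prop :=
  AnalyticOnNhd ℂ f {w : ℂ | w.re < 1 / 2} ∧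
    ∀ᶠ w in 𝓝 (0 : ℂ), f w = Complex.regularizedGaussHGFun A B C w

open Classical in
/-- The regularized Gauss hypergeometric function `F(A, B; C; w) / Γ(C)` on the half-plane
`Re w < 1/2`, as the analytic continuation of its Taylor series at `w = 0`.
It is defined for all complex `C`, including `C = 0, -1, -2, …`. -/
def gaussReg (A B C w : ℂ) : ℂ :=
  if h : ∃ f : ℂ → ℂ, IsGaussContinuation A B C f then h.choose w else 0

/-- The function `ψ_a(x; z, z', ξ)`, for `a` a half-integer and `x` a half-integer or a complex
number near the lattice of half-integers. On the lattice the number under the square root is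
positive, and the principal branch of the power `1/2` is the positive square root. -/
def psi (z z' : ℂ) (ξ : ℝ) (a x : ℂ) : ℂ :=
  (Complex.Gamma (x + z + 1 / 2) * Complex.Gamma (x + z' + 1 / 2) /
      (Complex.Gamma (z - a + 1 / 2) * Complex.Gamma (z' - a + 1 / 2))) ^ (1 / 2 : ℂ) *
    (ξ : ℂ) ^ ((x + a) / 2) *
    ((1 - ξ : ℝ) : ℂ) ^ ((z + z') / 2 - a) *
    gaussReg (-z + a + 1 / 2) (-z' + a + 1 / 2) (x + a + 1) ((ξ / (ξ - 1) : ℝ) : ℂ)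

/-- The discrete hypergeometric kernel: the sum of `ψ_a(x) ψ_a(y)` over the positive
half-integers `a = n + 1/2`, `n = 0, 1, 2, …`. -/
def kernel (z z' : ℂ) (ξ : ℝ) (x y : ℂ) : ℂ :=
  ∑' n : ℕ, psi z z' ξ ((n : ℂ) + 1 / 2) x * psi z z' ξ ((n : ℂ) + 1 / 2) y

/-- The numerator `ψ_{-1/2}(x) ψ_{1/2}(y) - ψ_{1/2}(x) ψ_{-1/2}(y)`. -/
def numerator (z z' : ℂ) (ξ : ℝ) (x y : ℂ) : ℂ :=
  psi z z' ξ (-1 / 2) x * psi z z' ξ (1 / 2) y - psi z z' ξ (1 / 2) x * psi z z' ξ (-1 / 2) y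

/-- The constant `√(z z' ξ) / (1 - ξ)`. In both series `z z' ξ > 0`, and the principal branch
gives the positive square root. -/
def prefactor (z z' : ℂ) (ξ : ℝ) : ℂ :=
  (z * z' * (ξ : ℂ)) ^ (1 / 2 : ℂ) / (1 - (ξ : ℂ))

end DiscreteHypergeometric

end

/-!
Put `a = j - 1/2`. Pfaff's transformation rewrites the hypergeometric factor of `ψ_a(x)` as
`(1 - ξ) ^ (j - z)` times the convergent series with parameters `A = j - z`, `D = x + z' + 1/2`,
`C = x + j + 1/2` and argument `ξ`. The powers of `1 - ξ` that depend on `a` then cancel, and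
`ψ_a(x) = commonFactor x * reducedPsi j x` for all complex `x`, where `commonFactor` does not depend
on `a` and `reducedPsi j` is an entire function (`GammaPositive.psi_eq`). The dependence of the
square root on `a` is a positive constant `gammaWeight j`; the principal and the complementary
series enter only through the positivity of all products `Γ(z + k) Γ(z' + k)`, `k ∈ ℤ`.

A contiguous relation for the Gauss series, checked on coefficients, becomes a symmetric three-term
relation in `j` in which `x` enters only as the eigenvalue `(1 - ξ) x`
(`GammaPositive.reducedPsi_three_term`). Hence `(1 - ξ) (x - y) ψ_a(x) ψ_a(y)` telescopes, as in the
Christoffel-Darboux formula, with lower boundary term `√(z z' ξ)` times the numerator of the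
integrable expression. Since `reducedPsi j` decays geometrically in `j`, uniformly for `x` in bounded
sets (`GammaPositive.reducedPsi_bound`), the series converges and the upper boundary term vanishes
in the limit.

The resulting identity holds for all complex `x` and `y`, so that it can be differentiated at
`y = x`, which gives the diagonal values. The analytic extension `Q` is expressed by the difference
quotients of the entire functions `reducedPsi 0` and `reducedPsi 1`, which are jointly analytic
(`analyticAt_dslope`), on the open set where `commonFactor` is analytic.
-/

noncomputable section

namespace DiscreteHypergeometric

open Complex

/-! ### Coefficients of the regularized Gauss series -/

/-- The coefficient of `t ^ n` in the regularized Gauss series `F(A, D; C; t) / Γ(C)`. -/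
def gaussCoeff (A D C : ℂ) (n : ℕ) : ℂ :=
  ((ascPochhammer ℂ n).eval A * (ascPochhammer ℂ n).eval D) / (n.factorial * Gamma (C + n))

theorem hasSum_regularizedGaussHGFun (A D C : ℂ) {t : ℂ} (ht : ‖t‖ < 1) :
    HasSum (fun n ↦ gaussCoeff A D C n * t ^ n) (regularizedGaussHGFun A D C t) := by
  have h := (regularizedGaussHGFunSeries A D C).hasSum (x := t) (by
    refine Metric.eball_subset_eball (radius_regularizedGaussHGFunSeries_ge_one A D C) ?_
    rw [← ENNReal.ofReal_one, Metric.eball_ofReal]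
    simpa using ht)
  refine h.congr_fun fun n ↦ ?_
  rw [FormalMultilinearSeries.apply_eq_prod_smul_coeff, coeff_regularizedGaussHGFunSeries,
    gaussCoeff]
  simp [mul_comm]

theorem analyticOnNhd_regularizedGaussHGFun (A D C : ℂ) :
    AnalyticOnNhd ℂ (regularizedGaussHGFun A D C) (Metric.ball 0 1) := by
  have h := ((regularizedGaussHGFunSeries A D C).hasFPowerSeriesOnBall
    (zero_lt_one.trans_le (radius_regularizedGaussHGFunSeries_ge_one A D C))).analyticOnNhd
  refine h.mono ?_
  rw [← Metric.eball_ofReal, ENNReal.ofReal_one]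
  exact Metric.eball_subset_eball (radius_regularizedGaussHGFunSeries_ge_one A D C)

theorem ascPochhammer_eval_succ (a : ℂ) (n : ℕ) :
    (ascPochhammer ℂ (n + 1)).eval a = (ascPochhammer ℂ n).eval a * (a + n) := by
  simp [ascPochhammer_succ_right]

theorem ascPochhammer_eval_succ' (a : ℂ) (n : ℕ) :
    (ascPochhammer ℂ (n + 1)).eval a = a * (ascPochhammer ℂ n).eval (a + 1) := by
  simp [ascPochhammer_succ_left]

/-- The functional equation in the form valid at all points: `1 / Γ` vanishes at the poles of `Γ`,
in agreement with the junk value `Γ(-k) = 0`. -/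
theorem inv_Gamma_eq (s : ℂ) : (Gamma s)⁻¹ = s * (Gamma (s + 1))⁻¹ := by
  simpa using one_div_Gamma_eq_self_mul_one_div_Gamma_add_one s

theorem ascPochhammer_mul_inv_Gamma (s : ℂ) (n : ℕ) :
    (ascPochhammer ℂ n).eval s * (Gamma (s + n))⁻¹ = (Gamma s)⁻¹ := by
  induction n with
  | zero => simp
  | succ n ih =>
    rw [← ih, ascPochhammer_eval_succ, inv_Gamma_eq (s + n)]
    push_cast
    ring_nf

/-- A form of the Chu-Vandermonde identity: the coefficient identity behind Pfaff's
transformation. -/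
theorem chu_vandermonde (N : ℕ) (C D : ℂ) :
    ∑ p ∈ Finset.HasAntidiagonal.antidiagonal N, (N.choose p.1 : ℂ) * ((-1) ^ p.1 *
      (ascPochhammer ℂ p.1).eval D * (ascPochhammer ℂ p.2).eval (C + p.1)) =
      (ascPochhammer ℂ N).eval (C - D) := by
  induction N generalizing C with
  | zero => simp
  | succ N ih =>
    have h := Finset.sum_antidiagonal_choose_succ_mul (fun i k ↦ (-1 : ℂ) ^ i *
      (ascPochhammer ℂ i).eval D * (ascPochhammer ℂ k).eval (C + i)) N
    rw [h, ascPochhammer_eval_succ', show C - D + 1 = C + 1 - D by ring, ← ih,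
      ← Finset.sum_add_distrib, Finset.mul_sum]
    refine Finset.sum_congr rfl fun p hp ↦ ?_
    rw [ascPochhammer_eval_succ', ascPochhammer_eval_succ]
    have h1 : p.2 + p.1 = N := by rw [add_comm]; simpa using hp
    have h2 : N.choose p.2 = N.choose p.1 := by
      rw [← h1]; exact Nat.choose_symm_add
    rw [h2]
    push_cast
    ring_nf

/-- With `B = C - D`, the parameters `A`, `B`, `C` are shifted simultaneously; `D` stays fixed, and
this is the shift of `a` in `ψ_a` after Pfaff's transformation. -/
theorem gaussCoeff_contiguous (A D C : ℂ) (n : ℕ) :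
    gaussCoeff (A - 1) D (C - 1) (n + 1) + A * (C - D) * gaussCoeff (A + 1) D (C + 1) n =
      (C - 1) * gaussCoeff A D C (n + 1) - (D - A) * gaussCoeff A D C n := by
  have e1 := ascPochhammer_eval_succ' (A - 1) n
  have e2 := ascPochhammer_eval_succ' A n
  have e3 := ascPochhammer_eval_succ A n
  have e4 := ascPochhammer_eval_succ D n
  have g := inv_Gamma_eq (C + n)
  have hn : ((n : ℂ) + 1) ≠ 0 := Nat.cast_add_one_ne_zero n
  have hf : (n.factorial : ℂ) ≠ 0 := by exact_mod_cast n.factorial_ne_zero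
  rw [sub_add_cancel] at e1
  rw [e3] at e2
  simp only [gaussCoeff, div_eq_mul_inv, mul_inv, Nat.factorial_succ, Nat.cast_mul, Nat.cast_add,
    Nat.cast_one]
  rw [e1, e3, e4, show C - 1 + ((n : ℂ) + 1) = C + n by ring,
    show C + 1 + (n : ℂ) = C + n + 1 by ring, ← add_assoc, g]
  field_simp
  linear_combination (- (C - D) * (ascPochhammer ℂ n).eval D * (n + 1) * (Gamma (C + n + 1))⁻¹) * e2

theorem regularizedGaussHGFun_contiguous (A D C : ℂ) {t : ℂ} (ht : ‖t‖ < 1) :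
    regularizedGaussHGFun (A - 1) D (C - 1) t +
        t * (A * (C - D)) * regularizedGaussHGFun (A + 1) D (C + 1) t =
      (C - 1 - t * (D - A)) * regularizedGaussHGFun A D C t := by
  have ha := hasSum_regularizedGaussHGFun (A - 1) D (C - 1) ht
  have hb := (hasSum_regularizedGaussHGFun (A + 1) D (C + 1) ht).mul_left (t * (A * (C - D)))
  have hc := hasSum_regularizedGaussHGFun A D C ht
  have ha' := (hasSum_nat_add_iff' 1).2 ha
  have hc' := ((hasSum_nat_add_iff' 1).2 hc).mul_left (C - 1)
  have h := (ha'.add hb).unique (((hc'.sub (hc.mul_left (t * (D - A))))).congr_fun ?_)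
  · have h0 : gaussCoeff (A - 1) D (C - 1) 0 = (C - 1) * gaussCoeff A D C 0 := by
      have := inv_Gamma_eq (C - 1)
      simp [gaussCoeff] at this ⊢
      exact this
    simp [h0] at h
    linear_combination h
  · intro n
    have := gaussCoeff_contiguous A D C n
    linear_combination t ^ (n + 1) * this

/-! ### Pfaff's transformation -/

theorem ringChoose_eq_ascPochhammer (s : ℂ) (n : ℕ) :
    Ring.choose (s + n - 1) n = (ascPochhammer ℂ n).eval s / n.factorial := by
  have hf : (n.factorial : ℂ) ≠ 0 := by exact_mod_cast n.factorial_ne_zero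
  rw [Ring.choose, show s + (n : ℂ) - 1 - n + 1 = s by ring, eq_div_iff hf, mul_comm,
    ← nsmul_eq_mul, Ring.factorial_nsmul_multichoose_eq_ascPochhammer,
    Polynomial.ascPochhammer_smeval_eq_eval]

/-- The binomial series, `(1 - t) ^ (-s) = ∑ₙ (s)ₙ tⁿ / n!`. -/
theorem hasSum_one_sub_cpow_neg (s : ℂ) {t : ℂ} (ht : ‖t‖ < 1) :
    HasSum (fun n ↦ (ascPochhammer ℂ n).eval s / n.factorial * t ^ n) ((1 - t) ^ (-s)) := by
  have h := (one_div_one_sub_cpow_hasFPowerSeriesOnBall_zero s).hasSum (y := t) (by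
    rw [← ENNReal.ofReal_one, Metric.eball_ofReal]
    simpa using ht)
  rw [zero_add, one_div, ← cpow_neg] at h
  refine h.congr_fun fun n ↦ ?_
  rw [← ringChoose_eq_ascPochhammer]
  simp [mul_comm]

theorem ascPochhammer_add (a : ℂ) (m n : ℕ) :
    (ascPochhammer ℂ (m + n)).eval a =
      (ascPochhammer ℂ m).eval a * (ascPochhammer ℂ n).eval (a + m) := by
  rw [← ascPochhammer_mul]
  simp

theorem norm_ascPochhammer_le {a : ℂ} {M : ℝ} (h : ‖a‖ ≤ M) (n : ℕ) :
    ‖(ascPochhammer ℂ n).eval a‖ ≤ (ascPochhammer ℝ n).eval M := by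
  have hM : 0 ≤ M := (norm_nonneg a).trans h
  induction n with
  | zero => simp
  | succ n ih =>
    rw [ascPochhammer_eval_succ, norm_mul]
    simp only [ascPochhammer_succ_right, Polynomial.eval_mul, Polynomial.eval_add,
      Polynomial.eval_X, Polynomial.eval_natCast]
    have : ‖a + n‖ ≤ M + n := (norm_add_le _ _).trans (by simpa using h)
    gcongr
    exact (norm_nonneg _).trans ih

theorem hasSum_one_sub_rpow_neg (s : ℝ) {t : ℝ} (h0 : 0 ≤ t) (h1 : t < 1) :
    HasSum (fun n ↦ (ascPochhammer ℝ n).eval s / n.factorial * t ^ n) ((1 - t) ^ (-s)) := by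
  have h := hasSum_one_sub_cpow_neg (s : ℂ) (t := t) (by simpa [abs_of_nonneg h0] using h1)
  rw [← hasSum_ofReal]
  rw [ofReal_cpow (by linarith)]
  push_cast
  refine h.congr_fun fun n ↦ ?_
  congr 2
  rw [← ofRealHom_eq_coe, ← ofRealHom_eq_coe, ← Polynomial.eval_map_apply, ascPochhammer_map]

theorem gaussCoeff_bound (A D C : ℂ) : ∃ K : ℝ, 0 ≤ K ∧ ∀ n, ‖gaussCoeff A D C n‖ ≤ K * 2 ^ n := by
  obtain ⟨K, hK, h⟩ := (regularizedGaussHGFunSeries A D C).norm_mul_pow_le_of_lt_radius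
    (r := 1 / 2) (lt_of_lt_of_le (by
      rw [← ENNReal.coe_one, ENNReal.coe_lt_coe]; exact NNReal.half_lt_self one_ne_zero)
      (radius_regularizedGaussHGFunSeries_ge_one A D C))
  refine ⟨K, hK.le, fun n ↦ ?_⟩
  have h1 := h n
  rw [FormalMultilinearSeries.norm_apply_eq_norm_coef, coeff_regularizedGaussHGFunSeries] at h1
  have h2 : ‖gaussCoeff A D C n‖ * (1 / 2) ^ n ≤ K := h1
  rw [one_div, inv_pow, ← div_eq_mul_inv, div_le_iff₀ (by positivity)] at h2
  exact h2

/-- Pfaff's transformation near the origin. -/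
theorem pfaff_of_norm_small (A D C : ℂ) {w : ℂ} (hw : ‖w‖ < 1 / 4) :
    (1 - w) ^ (-A) * regularizedGaussHGFun A D C (w / (w - 1)) =
      regularizedGaussHGFun A (C - D) C w := by
  set r := ‖w‖ with hr
  have hr0 : 0 ≤ r := norm_nonneg w
  have h1w : 1 - w ≠ 0 := by
    intro h
    have : w = 1 := by linear_combination -h
    rw [this] at hr; norm_num at hr; linarith
  have hn1 : 1 - r ≤ ‖w - 1‖ := by
    have := norm_sub_norm_le (1 : ℂ) w
    rw [norm_sub_rev] at this
    simpa using this
  -- expanding `(1 - w) ^ (-A - n)` in each term gives an absolutely convergent double series,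
  -- summed below by rows and by antidiagonals
  let F : ℕ × ℕ → ℂ := fun p ↦ gaussCoeff A D C p.1 * (-w) ^ p.1 *
    ((ascPochhammer ℂ p.2).eval (A + p.1) / p.2.factorial * w ^ p.2)
  have hsum : Summable F := by
    obtain ⟨K, hK, hb⟩ := gaussCoeff_bound A D C
    let G : ℕ × ℕ → ℝ := fun p ↦ K * 2 ^ p.1 * r ^ p.1 *
      ((ascPochhammer ℝ p.2).eval (‖A‖ + p.1) / p.2.factorial * r ^ p.2)
    have hnn : ∀ p : ℕ × ℕ, 0 ≤ (ascPochhammer ℝ p.2).eval (‖A‖ + p.1) := fun p ↦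
      (norm_nonneg _).trans (norm_ascPochhammer_le (a := A + p.1)
        ((norm_add_le _ _).trans (by simp)) p.2)
    have hin : ∀ n : ℕ, HasSum (fun m ↦ G (n, m))
        (K * 2 ^ n * r ^ n * (1 - r) ^ (-(‖A‖ + n))) := fun n ↦
      (hasSum_one_sub_rpow_neg (‖A‖ + n) hr0 (by linarith)).mul_left _
    refine Summable.of_norm_bounded (g := G) ?_ fun p ↦ ?_
    · rw [summable_prod_of_nonneg fun p ↦ by have := hnn p; simp only [G, Pi.zero_apply]; positivity]
      refine ⟨fun n ↦ (hin n).summable, ?_⟩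
      simp_rw [fun n ↦ (hin n).tsum_eq]
      have : ∀ n : ℕ, K * 2 ^ n * r ^ n * (1 - r) ^ (-(‖A‖ + n)) =
          K * (1 - r) ^ (-‖A‖) * (2 * r / (1 - r)) ^ n := by
        intro n
        rw [neg_add, Real.rpow_add (by linarith), Real.rpow_neg (y := (n : ℝ)) (by linarith),
          Real.rpow_natCast, div_pow, mul_pow]
        ring
      simp_rw [this]
      refine (summable_geometric_of_lt_one (div_nonneg (by linarith) (by linarith)) ?_).mul_left _
      rw [div_lt_one (by linarith)]
      linarith
    · simp only [F, G, norm_mul, norm_div, norm_pow, norm_neg, RCLike.norm_natCast, ← hr]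
      have h2 := norm_ascPochhammer_le (a := A + p.1) (M := ‖A‖ + p.1)
        ((norm_add_le _ _).trans (by simp)) p.2
      have h3 := hb p.1
      gcongr
  have hrow : ∀ n : ℕ, HasSum (fun m ↦ F (n, m))
      ((1 - w) ^ (-A) * (gaussCoeff A D C n * (w / (w - 1)) ^ n)) := by
    intro n
    have h := (hasSum_one_sub_cpow_neg (A + n) (t := w) (by linarith)).mul_left
      (gaussCoeff A D C n * (-w) ^ n)
    have e : w / (w - 1) = -w * (1 - w)⁻¹ := by
      rw [← neg_sub 1 w, div_neg, div_eq_mul_inv]; ring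
    rw [neg_add, cpow_add _ _ h1w, cpow_neg _ (n : ℂ), cpow_natCast] at h
    rw [e, mul_pow, inv_pow]
    convert! h using 1
    ring
  have h1 : HasSum (fun n ↦ (1 - w) ^ (-A) * (gaussCoeff A D C n * (w / (w - 1)) ^ n)) (∑' p, F p) :=
    hsum.hasSum.prod_fiberwise hrow
  have h2 : HasSum (fun N ↦ gaussCoeff A (C - D) C N * w ^ N) (∑' p, F p) := by
    have h3 := (Finset.HasAntidiagonal.sigmaAntidiagonalEquivProd.hasSum_iff.2 hsum.hasSum).sigma
      fun N ↦ hasSum_fintype _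
    refine h3.congr_fun fun N ↦ ?_
    rw [gaussCoeff, ← chu_vandermonde, mul_div_assoc, Finset.sum_div, Finset.mul_sum,
      Finset.sum_mul]
    simp only [Function.comp_apply]
    rw [← Finset.sum_coe_sort]
    refine Finset.sum_congr rfl fun p _ ↦ ?_
    obtain ⟨⟨i, k⟩, hp⟩ := p
    have hN : i + k = N := by simpa using hp
    subst hN
    have hi : (i.factorial : ℂ) ≠ 0 := by exact_mod_cast i.factorial_ne_zero
    have hk : (k.factorial : ℂ) ≠ 0 := by exact_mod_cast k.factorial_ne_zero
    have hg := ascPochhammer_mul_inv_Gamma (C + i) k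
    have hch : (((i + k).choose i : ℕ) : ℂ) = (i + k).factorial / (i.factorial * k.factorial) := by
      rw [Nat.cast_add_choose]
    have hik : ((i + k).factorial : ℂ) ≠ 0 := by exact_mod_cast (i + k).factorial_ne_zero
    simp only [Finset.HasAntidiagonal.sigmaAntidiagonalEquivProd, Equiv.coe_fn_mk, F, gaussCoeff,
      div_eq_mul_inv, mul_inv]
    rw [← hg, hch, ascPochhammer_add, neg_pow w, pow_add]
    push_cast
    rw [add_assoc C]
    field_simp
  exact ((hasSum_regularizedGaussHGFun A D C (t := w / (w - 1)) (by
    rw [norm_div, div_lt_one (by linarith)]; linarith)).mul_left _).unique h1 |>.trans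
    (h2.unique (hasSum_regularizedGaussHGFun A (C - D) C (by linarith)))

theorem norm_div_sub_one_lt_one {w : ℂ} (hw : w.re < 1 / 2) : ‖w / (w - 1)‖ < 1 := by
  have h1 : w - 1 ≠ 0 := by
    intro h
    have : w = 1 := by linear_combination h
    rw [this] at hw; norm_num at hw
  rw [norm_div, div_lt_one (norm_pos_iff.2 h1), ← sq_lt_sq₀ (norm_nonneg _) (norm_nonneg _),
    Complex.sq_norm, Complex.sq_norm, normSq_apply, normSq_apply]
  simp
  nlinarith

/-- Pfaff's transformation provides the analytic continuation of the Gauss series to the half-plane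
`Re w < 1 / 2`: there the argument `w / (w - 1)` stays in the unit disc. -/
theorem isGaussContinuation_pfaff (A B C : ℂ) : IsGaussContinuation A B C fun w ↦
    (1 - w) ^ (-A) * regularizedGaussHGFun A (C - B) C (w / (w - 1)) := by
  constructor
  · intro w hw
    have hw' : w.re < 1 / 2 := hw
    have h1 : w - 1 ≠ 0 := by
      intro h
      have : w = 1 := by linear_combination h
      rw [this] at hw'; norm_num at hw'
    refine AnalyticAt.mul ?_ ?_
    · refine (analyticAt_const.sub analyticAt_id).cpow analyticAt_const ?_
      left
      simp
      linarith
    · have h2 : AnalyticAt ℂ (fun w : ℂ ↦ w / (w - 1)) w :=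
        analyticAt_id.div (analyticAt_id.sub analyticAt_const) h1
      refine AnalyticAt.fun_comp (analyticOnNhd_regularizedGaussHGFun A (C - B) C _ ?_) h2
      simpa using norm_div_sub_one_lt_one hw'
  · filter_upwards [Metric.ball_mem_nhds (0 : ℂ) (show (0 : ℝ) < 1 / 4 by norm_num)] with w hw
    rw [pfaff_of_norm_small _ _ _ (by simpa using hw), sub_sub_cancel]

theorem gaussReg_eq_pfaff (A B C : ℂ) {w : ℂ} (hw : w.re < 1 / 2) :
    gaussReg A B C w = (1 - w) ^ (-A) * regularizedGaussHGFun A (C - B) C (w / (w - 1)) := by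
  have hex : ∃ f : ℂ → ℂ, IsGaussContinuation A B C f := ⟨_, isGaussContinuation_pfaff A B C⟩
  rw [gaussReg, dif_pos hex]
  have hp := isGaussContinuation_pfaff A B C
  refine hex.choose_spec.1.eqOn_of_preconnected_of_eventuallyEq hp.1
    (convex_halfSpace_re_lt _).isPreconnected (z₀ := 0) (by simp) ?_ hw
  filter_upwards [hex.choose_spec.2, hp.2] with w h1 h2
  rw [h1, h2]

/-- At `w = ξ / (ξ - 1)`, the argument occurring in `ψ_a`, one has `1 - w = 1 / (1 - ξ)` and
`w / (w - 1) = ξ`. -/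
theorem gaussReg_negative_argument (A B C : ℂ) {ξ : ℝ} (h0 : 0 < ξ) (h1 : ξ < 1) :
    gaussReg A B C ((ξ / (ξ - 1) : ℝ) : ℂ) =
      ((1 - ξ : ℝ) : ℂ) ^ A * regularizedGaussHGFun A (C - B) C ξ := by
  have hr : ξ / (ξ - 1) ≤ 0 := div_nonpos_of_nonneg_of_nonpos h0.le (by linarith)
  have hξ : (ξ : ℂ) - 1 ≠ 0 := by
    rw [← ofReal_one, ← ofReal_sub, ofReal_ne_zero]; linarith
  rw [gaussReg_eq_pfaff _ _ _ (by rw [ofReal_re]; linarith)]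
  have e1 : (1 : ℂ) - ((ξ / (ξ - 1) : ℝ) : ℂ) = (((1 - ξ : ℝ) : ℂ))⁻¹ := by
    push_cast
    have : (1 : ℂ) - ξ ≠ 0 := by rwa [← neg_ne_zero, neg_sub]
    field_simp
    ring
  have e2 : ((ξ / (ξ - 1) : ℝ) : ℂ) / (((ξ / (ξ - 1) : ℝ) : ℂ) - 1) = ξ := by
    push_cast
    rw [div_sub_one hξ, sub_sub_cancel, div_div_div_cancel_right₀ hξ, div_one]
  rw [e2, e1, cpow_neg, inv_cpow_ofReal_nonneg (by linarith), inv_inv]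

/-! ### Positivity, the common factor of `ψ_a`, and the three-term relation -/

/-- The form in which the hypothesis on the parameters is used: all the numbers
`Γ(z + k) Γ(z' + k)`, with `k` an integer, are (finite and) positive. -/
def GammaPositive (z z' : ℂ) : Prop :=
  ∀ k : ℤ, ∃ r : ℝ, 0 < r ∧ Gamma (z + k) * Gamma (z' + k) = r

theorem PrincipalSeries.gammaPositive {z z' : ℂ} (h : PrincipalSeries z z') :
    GammaPositive z z' := by
  obtain ⟨him, rfl⟩ := h
  intro k
  have hne : Gamma (z + k) ≠ 0 := Gamma_ne_zero fun m hm ↦ him (by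
    simpa using congrArg im hm)
  refine ⟨normSq (Gamma (z + k)), normSq_pos.2 hne, ?_⟩
  rw [← mul_conj, ← Gamma_conj]
  simp

/-- The sign of the real Gamma function is constant between consecutive integers. The induction is
on a bound `-n` from below for the left endpoint `m`. -/
theorem realGamma_mul_realGamma_pos (n : ℕ) : ∀ (m : ℤ), -(n : ℤ) ≤ m → ∀ u ∈ Ioo (m : ℝ) (m + 1),
    ∀ v ∈ Ioo (m : ℝ) (m + 1), 0 < Real.Gamma u * Real.Gamma v := by
  induction n with
  | zero =>
    intro m hm u hu v hv
    have : (0 : ℝ) ≤ m := by exact_mod_cast (by simpa using hm : (0 : ℤ) ≤ m)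
    exact mul_pos (Real.Gamma_pos_of_pos (this.trans_lt hu.1))
      (Real.Gamma_pos_of_pos (this.trans_lt hv.1))
  | succ n ih =>
    intro m hm u hu v hv
    rcases le_or_gt 0 m with h0 | h0
    · have : (0 : ℝ) ≤ m := by exact_mod_cast h0
      exact mul_pos (Real.Gamma_pos_of_pos (this.trans_lt hu.1))
        (Real.Gamma_pos_of_pos (this.trans_lt hv.1))
    · have hm1 : (m : ℝ) + 1 ≤ 0 := by exact_mod_cast h0
      have hu0 : u < 0 := hu.2.trans_le hm1
      have hv0 : v < 0 := hv.2.trans_le hm1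
      have h := ih (m + 1) (by push_cast at hm; omega) (u + 1)
        (by push_cast; exact ⟨by linarith [hu.1], by linarith [hu.2]⟩) (v + 1)
        (by push_cast; exact ⟨by linarith [hv.1], by linarith [hv.2]⟩)
      rw [Real.Gamma_add_one hu0.ne, Real.Gamma_add_one hv0.ne] at h
      have h2 := mul_pos_of_neg_of_neg hu0 hv0
      have h3 : 0 < (u * v) * (Real.Gamma u * Real.Gamma v) := by linarith
      exact (pos_iff_pos_of_mul_pos h3).1 h2

theorem ComplementarySeries.gammaPositive {z z' : ℂ} (h : ComplementarySeries z z') :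
    GammaPositive z z' := by
  obtain ⟨h1, h2, m, hu, hv⟩ := h
  have e1 : z = (z.re : ℂ) := by apply Complex.ext <;> simp [h1]
  have e2 : z' = (z'.re : ℂ) := by apply Complex.ext <;> simp [h2]
  intro k
  refine ⟨Real.Gamma (z.re + k) * Real.Gamma (z'.re + k),
    realGamma_mul_realGamma_pos (m + k).natAbs (m + k) (by omega) _ ?_ _ ?_, ?_⟩
  · push_cast; exact ⟨by linarith [hu.1], by linarith [hu.2]⟩
  · push_cast; exact ⟨by linarith [hv.1], by linarith [hv.2]⟩
  · rw [ofReal_mul, ← Gamma_ofReal, ← Gamma_ofReal]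
    push_cast
    rw [← e1, ← e2]

variable {z z' : ℂ}

theorem GammaPositive.add_ne_zero (h : GammaPositive z z') (k : ℤ) : z + k ≠ 0 ∧ z' + k ≠ 0 := by
  obtain ⟨r, hr, e⟩ := h k
  have : (r : ℂ) ≠ 0 := by exact_mod_cast hr.ne'
  constructor <;> intro h0 <;> rw [h0] at e <;> simp at e <;> exact this e.symm

/-- `(j - z)(j - z')`, a positive real number if `GammaPositive z z'`. -/
def shiftProduct (z z' : ℂ) (j : ℕ) : ℝ := ((j - z) * (j - z')).re

/-- `(Γ(z - a + 1/2) Γ(z' - a + 1/2)) ^ (-1/2)` for `a = j - 1/2`. -/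
def gammaWeight (z z' : ℂ) (j : ℕ) : ℝ := (√(Gamma (z - j + 1) * Gamma (z' - j + 1)).re)⁻¹

theorem GammaPositive.gamma_sub (h : GammaPositive z z') (j : ℕ) :
    0 < (Gamma (z - j + 1) * Gamma (z' - j + 1)).re ∧
      Gamma (z - j + 1) * Gamma (z' - j + 1) =
        (Gamma (z - j + 1) * Gamma (z' - j + 1)).re := by
  obtain ⟨r, hr, e⟩ := h (1 - j)
  have h1 : z - j + 1 = z + ((1 - j : ℤ) : ℂ) := by push_cast; ring
  have h2 : z' - j + 1 = z' + ((1 - j : ℤ) : ℂ) := by push_cast; ring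
  rw [h1, h2, e, ofReal_re]
  exact ⟨hr, rfl⟩

theorem GammaPositive.gammaWeight_pos (h : GammaPositive z z') (j : ℕ) :
    0 < gammaWeight z z' j :=
  inv_pos.2 (Real.sqrt_pos.2 (h.gamma_sub j).1)

theorem GammaPositive.gamma_step (h : GammaPositive z z') (j : ℕ) :
    Gamma (z - j + 1) * Gamma (z' - j + 1) = ((j - z) * (j - z')) *
      (Gamma (z - (j + 1 : ℕ) + 1) * Gamma (z' - (j + 1 : ℕ) + 1)) := by
  have h1 := h.add_ne_zero (-j)
  push_cast at h1
  rw [← sub_eq_add_neg, ← sub_eq_add_neg] at h1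
  rw [Gamma_add_one _ h1.1, Gamma_add_one _ h1.2]
  push_cast
  rw [show z - ((j : ℂ) + 1) + 1 = z - j by ring, show z' - ((j : ℂ) + 1) + 1 = z' - j by ring]
  ring

theorem GammaPositive.shiftProduct_spec (h : GammaPositive z z') (j : ℕ) :
    0 < shiftProduct z z' j ∧ ((j - z) * (j - z') : ℂ) = shiftProduct z z' j := by
  have e := h.gamma_step j
  obtain ⟨h1, e1⟩ := h.gamma_sub j
  obtain ⟨h2, e2⟩ := h.gamma_sub (j + 1)
  rw [e1, e2] at e
  set r := (Gamma (z - j + 1) * Gamma (z' - j + 1)).re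
  set s := (Gamma (z - (j + 1 : ℕ) + 1) * Gamma (z' - (j + 1 : ℕ) + 1)).re
  have hs : (s : ℂ) ≠ 0 := by exact_mod_cast h2.ne'
  have e3 : ((j - z) * (j - z') : ℂ) = (r / s : ℝ) := by
    rw [ofReal_div, eq_div_iff hs, e]
  rw [shiftProduct, e3, ofReal_re]
  exact ⟨div_pos h1 h2, rfl⟩

theorem GammaPositive.gammaWeight_succ (h : GammaPositive z z') (j : ℕ) :
    gammaWeight z z' (j + 1) = gammaWeight z z' j * √(shiftProduct z z' j) := by
  have e : (Gamma (z - j + 1) * Gamma (z' - j + 1)).re = shiftProduct z z' j *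
      (Gamma (z - (j + 1 : ℕ) + 1) * Gamma (z' - (j + 1 : ℕ) + 1)).re := by
    have := h.gamma_step j
    rw [(h.shiftProduct_spec j).2, (h.gamma_sub j).2, (h.gamma_sub (j + 1)).2] at this
    exact_mod_cast this
  have hp := Real.sqrt_pos.2 (h.shiftProduct_spec j).1
  have hg := Real.sqrt_pos.2 (h.gamma_sub (j + 1)).1
  rw [gammaWeight, gammaWeight, e, Real.sqrt_mul (h.shiftProduct_spec j).1.le]
  field_simp

/-- The factor of `ψ_a(x)` that depends only on `x`. -/
def commonFactor (z z' : ℂ) (ξ : ℝ) (x : ℂ) : ℂ :=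
  (Gamma (x + z + 1 / 2) * Gamma (x + z' + 1 / 2)) ^ (1 / 2 : ℂ) * (ξ : ℂ) ^ (x / 2 - 1 / 4) *
    ((1 - ξ : ℝ) : ℂ) ^ ((z' - z + 1) / 2)

/-- The quotient of `ψ_a(x)`, `a = j - 1/2`, by `commonFactor`, an entire function of `x`. -/
def reducedPsi (z z' : ℂ) (ξ : ℝ) (j : ℕ) (x : ℂ) : ℂ :=
  gammaWeight z z' j * (√ξ : ℂ) ^ j *
    regularizedGaussHGFun (j - z) (x + z' + 1 / 2) (x + j + 1 / 2) ξ

/-- A positive factor splits off a principal power, whatever the other factor is. -/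
theorem mul_ofReal_cpow {r : ℝ} (hr : 0 < r) (w s : ℂ) :
    (w * r) ^ s = w ^ s * (r : ℂ) ^ s := by
  have hr' : (r : ℂ) ≠ 0 := by exact_mod_cast hr.ne'
  rcases eq_or_ne s 0 with rfl | hs
  · simp
  rcases eq_or_ne w 0 with rfl | hw
  · simp [hs]
  rw [cpow_def_of_ne_zero (mul_ne_zero hw hr'), cpow_def_of_ne_zero hw, cpow_def_of_ne_zero hr',
    log_mul_ofReal r hr w hw, ← ofReal_log hr.le, ← exp_add]
  ring_nf

theorem ofReal_cpow_half {r : ℝ} (hr : 0 ≤ r) : (r : ℂ) ^ (1 / 2 : ℂ) = (√r : ℝ) := by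
  rw [Real.sqrt_eq_rpow, ofReal_cpow hr]
  norm_num

/-- The factorization holds for every complex `x`, also where the branch of the square root is
discontinuous, because the factor split off from under the root is a positive number. -/
theorem GammaPositive.psi_eq (h : GammaPositive z z') {ξ : ℝ} (h0 : 0 < ξ) (h1 : ξ < 1) (j : ℕ)
    (x : ℂ) :
    psi z z' ξ (j - 1 / 2) x = commonFactor z z' ξ x * reducedPsi z z' ξ j x := by
  obtain ⟨hg, eg⟩ := h.gamma_sub j
  have hξ : (ξ : ℂ) ≠ 0 := by exact_mod_cast h0.ne'
  have hξ1 : ((1 - ξ : ℝ) : ℂ) ≠ 0 := by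
    rw [ofReal_ne_zero]; linarith
  rw [psi, gaussReg_negative_argument _ _ _ h0 h1, commonFactor, reducedPsi,
    show z - ((j : ℂ) - 1 / 2) + 1 / 2 = z - j + 1 by ring,
    show z' - ((j : ℂ) - 1 / 2) + 1 / 2 = z' - j + 1 by ring, eg, div_eq_mul_inv, ← ofReal_inv,
    mul_ofReal_cpow (inv_pos.2 hg), ofReal_cpow_half (inv_pos.2 hg).le, Real.sqrt_inv, ← gammaWeight,
    show -z + ((j : ℂ) - 1 / 2) + 1 / 2 = j - z by ring,
    show x + ((j : ℂ) - 1 / 2) + 1 = x + j + 1 / 2 by ring,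
    show x + (j : ℂ) + 1 / 2 - (-z' + ((j : ℂ) - 1 / 2) + 1 / 2) = x + z' + 1 / 2 by ring]
  have e1 : (ξ : ℂ) ^ ((x + ((j : ℂ) - 1 / 2)) / 2) = (ξ : ℂ) ^ (x / 2 - 1 / 4) * (√ξ : ℂ) ^ j := by
    rw [← ofReal_cpow_half h0.le, ← cpow_nat_mul, ← cpow_add _ _ hξ]
    congr 1; ring
  have e2 : ((1 - ξ : ℝ) : ℂ) ^ ((z' - z + 1) / 2) =
      ((1 - ξ : ℝ) : ℂ) ^ ((z + z') / 2 - ((j : ℂ) - 1 / 2)) * ((1 - ξ : ℝ) : ℂ) ^ ((j : ℂ) - z) := by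
    rw [← cpow_add _ _ hξ1]
    congr 1; ring
  rw [e1, e2]
  ring

/-- The three-term relation in the index `a = j + 1/2`. -/
theorem GammaPositive.reducedPsi_three_term (h : GammaPositive z z') {ξ : ℝ} (h0 : 0 < ξ)
    (h1 : ξ < 1) (j : ℕ) (x : ℂ) :
    (1 - ξ) * x * reducedPsi z z' ξ (j + 1) x =
      √(ξ * shiftProduct z z' j) * reducedPsi z z' ξ j x +
      √(ξ * shiftProduct z z' (j + 1)) * reducedPsi z z' ξ (j + 2) x +
      (-(j + 1 / 2) + ξ * (z + z' - (j + 1 / 2))) * reducedPsi z z' ξ (j + 1) x := by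
  have hc := regularizedGaussHGFun_contiguous ((j + 1 : ℕ) - z) (x + z' + 1 / 2)
    (x + (j + 1 : ℕ) + 1 / 2) (t := ξ) (by simpa [abs_of_pos h0] using h1)
  have hs : (√ξ : ℂ) ^ 2 = ξ := by
    rw [← ofReal_pow, Real.sq_sqrt h0.le]
  have hp : ((√(shiftProduct z z' (j + 1)) : ℝ) : ℂ) ^ 2 =
      ((j + 1 : ℕ) - z) * ((j + 1 : ℕ) - z') := by
    rw [(h.shiftProduct_spec (j + 1)).2, ← ofReal_pow, Real.sq_sqrt (h.shiftProduct_spec (j + 1)).1.le]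
  simp only [reducedPsi]
  rw [show j + 2 = (j + 1) + 1 from rfl, h.gammaWeight_succ (j + 1), h.gammaWeight_succ j,
    Real.sqrt_mul h0.le, Real.sqrt_mul h0.le]
  rw [show x + ((j + 1 : ℕ) : ℂ) + 1 / 2 - (x + z' + 1 / 2) = (j + 1 : ℕ) - z' by ring, ← hp] at hc
  push_cast at hc ⊢
  rw [show (j : ℂ) + 1 - z - 1 = j - z by ring,
    show (j : ℂ) + 1 - z + 1 = j + 1 + 1 - z by ring,
    show x + ((j : ℂ) + 1) + 1 / 2 - 1 = x + j + 1 / 2 by ring,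
    show x + ((j : ℂ) + 1) + 1 / 2 + 1 = x + (j + 1 + 1) + 1 / 2 by ring] at hc
  have hs' : (√ξ : ℂ) ^ j * √ξ * ((√ξ : ℂ) ^ 2 - ξ) = 0 := by rw [hs]; ring
  linear_combination (-(gammaWeight z z' j * √(shiftProduct z z' j) * √ξ ^ (j + 1) : ℂ)) * hc -
    (gammaWeight z z' j * √(shiftProduct z z' j) * √(shiftProduct z z' (j + 1)) ^ 2 *
      regularizedGaussHGFun (j + 1 + 1 - z) (x + z' + 1 / 2) (x + (j + 1 + 1) + 1 / 2) ξ) * hs'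

/-! ### Uniform geometric bounds -/

theorem ascPochhammer_real_eval_succ (M : ℝ) (n : ℕ) :
    (ascPochhammer ℝ (n + 1)).eval M = (ascPochhammer ℝ n).eval M * (M + n) := by
  simp [ascPochhammer_succ_right]

theorem ascPochhammer_real_eval_nonneg {M : ℝ} (hM : 0 ≤ M) (n : ℕ) :
    0 ≤ (ascPochhammer ℝ n).eval M := by
  induction n with
  | zero => simp
  | succ n ih => rw [ascPochhammer_real_eval_succ]; positivity

/-- The quotient `(M)_N / Γ(s + N)` grows more slowly than any geometric progression with ratio
larger than `1`, uniformly for `s` in a bounded set. This replaces Stirling's formula. -/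
theorem ascPochhammer_div_Gamma_bound {M R η : ℝ} (hM : 0 ≤ M) (hη : 1 < η) :
    ∃ K : ℝ, 0 ≤ K ∧ ∀ s : ℂ, ‖s‖ ≤ R → ∀ N : ℕ,
      (ascPochhammer ℝ N).eval M * ‖(Gamma (s + N))⁻¹‖ ≤ K * η ^ N := by
  have hcpt : ∀ N : ℕ, ∃ K : ℝ, 0 ≤ K ∧ ∀ s : ℂ, ‖s‖ ≤ R →
      (ascPochhammer ℝ N).eval M * ‖(Gamma (s + N))⁻¹‖ ≤ K := by
    intro N
    have hcont : Continuous fun s : ℂ ↦ (ascPochhammer ℝ N).eval M * ‖(Gamma (s + N))⁻¹‖ := by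
      have := differentiable_one_div_Gamma.continuous
      exact continuous_const.mul (this.comp (continuous_id.add continuous_const)).norm
    obtain ⟨K, hK⟩ := (isCompact_closedBall (0 : ℂ) R).bddAbove_image hcont.continuousOn
    refine ⟨max K 0, le_max_right _ _, fun s hs ↦ (hK ⟨s, by simpa using hs, rfl⟩).trans
      (le_max_left _ _)⟩
  choose k hk0 hk using hcpt
  obtain ⟨N₀, hN₀⟩ := exists_nat_ge ((M + η * R) / (η - 1))
  rw [div_le_iff₀ (by linarith)] at hN₀
  have hsum0 : 0 ≤ ∑ i ∈ Finset.range (N₀ + 1), k i := Finset.sum_nonneg fun i _ ↦ hk0 i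
  refine ⟨∑ i ∈ Finset.range (N₀ + 1), k i, hsum0, fun s hs N ↦ ?_⟩
  have hsmall : ∀ N ≤ N₀, (ascPochhammer ℝ N).eval M * ‖(Gamma (s + N))⁻¹‖ ≤
      (∑ i ∈ Finset.range (N₀ + 1), k i) * η ^ N := by
    intro N hN
    calc _ ≤ k N := hk N s hs
      _ ≤ ∑ i ∈ Finset.range (N₀ + 1), k i :=
        Finset.single_le_sum (fun i _ ↦ hk0 i) (Finset.mem_range.2 (by omega))
      _ ≤ _ := le_mul_of_one_le_right hsum0 (one_le_pow₀ hη.le)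
  rcases le_total N N₀ with h | h
  · exact hsmall N h
  induction N, h using Nat.le_induction with
  | base => exact hsmall N₀ le_rfl
  | succ N hN ih =>
    have hNr : (N₀ : ℝ) ≤ N := by exact_mod_cast hN
    -- the choice of `N₀` gives `M + N ≤ η * (N - R) ≤ η * ‖s + N‖`
    have h1 : M + N ≤ η * ‖s + N‖ := by
      have h2 : (N : ℝ) - R ≤ ‖s + N‖ := by
        have := norm_sub_norm_le (N : ℂ) (-s)
        rw [sub_neg_eq_add, add_comm (N : ℂ), norm_neg, Complex.norm_natCast] at this
        linarith
      nlinarith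
    have hg := inv_Gamma_eq (s + N)
    rw [hg, norm_mul] at ih
    rw [ascPochhammer_real_eval_succ, pow_succ]
    push_cast
    rw [← add_assoc]
    have hP := ascPochhammer_real_eval_nonneg hM N
    calc (ascPochhammer ℝ N).eval M * (M + N) * ‖(Gamma (s + N + 1))⁻¹‖
        ≤ (ascPochhammer ℝ N).eval M * (η * ‖s + N‖) * ‖(Gamma (s + N + 1))⁻¹‖ := by gcongr
      _ = η * ((ascPochhammer ℝ N).eval M * (‖s + N‖ * ‖(Gamma (s + N + 1))⁻¹‖)) := by ring
      _ ≤ η * ((∑ i ∈ Finset.range (N₀ + 1), k i) * η ^ N) := by gcongr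
      _ = _ := by ring

theorem ascPochhammer_div_factorial_bound {M η : ℝ} (hM : 0 ≤ M) (hη : 1 < η) :
    ∃ K : ℝ, 0 ≤ K ∧ ∀ N : ℕ, (ascPochhammer ℝ N).eval M / N.factorial ≤ K * η ^ N := by
  obtain ⟨K, hK, h⟩ := ascPochhammer_div_Gamma_bound (R := 1) hM hη
  refine ⟨K, hK, fun N ↦ ?_⟩
  have := h 1 (by simp) N
  rw [add_comm, Gamma_nat_eq_factorial, norm_inv, Complex.norm_natCast] at this
  rwa [div_eq_mul_inv]

theorem GammaPositive.gammaWeight_le (h : GammaPositive z z') {M : ℝ} (hz : ‖z‖ ≤ M)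
    (hz' : ‖z'‖ ≤ M) (j : ℕ) :
    gammaWeight z z' j ≤ gammaWeight z z' 0 * (ascPochhammer ℝ j).eval M := by
  have hM : 0 ≤ M := (norm_nonneg _).trans hz
  induction j with
  | zero => simp
  | succ j ih =>
    rw [h.gammaWeight_succ, ascPochhammer_real_eval_succ, ← mul_assoc]
    have hb : ∀ w : ℂ, ‖w‖ ≤ M → ‖(j : ℂ) - w‖ ≤ M + j := fun w hw ↦ by
      have := norm_sub_le (j : ℂ) w
      rw [Complex.norm_natCast] at this
      linarith
    have hs : √(shiftProduct z z' j) ≤ M + j := by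
      refine Real.sqrt_le_iff.2 ⟨by positivity, (re_le_norm _).trans ?_⟩
      rw [norm_mul, sq]
      exact mul_le_mul (hb z hz) (hb z' hz') (norm_nonneg _) (by positivity)
    have := ascPochhammer_real_eval_nonneg hM j
    have := (h.gammaWeight_pos 0).le
    gcongr

theorem ascPochhammer_real_add (a : ℝ) (m n : ℕ) :
    (ascPochhammer ℝ (m + n)).eval a =
      (ascPochhammer ℝ m).eval a * (ascPochhammer ℝ n).eval (a + m) := by
  rw [← ascPochhammer_mul]
  simp

/-- The `n`-th term of the series defining `reducedPsi z z' ξ j x`. -/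
def reducedPsiTerm (z z' : ℂ) (ξ : ℝ) (j n : ℕ) (x : ℂ) : ℂ :=
  gammaWeight z z' j * (√ξ : ℂ) ^ j *
    (gaussCoeff (j - z) (x + z' + 1 / 2) (x + j + 1 / 2) n * (ξ : ℂ) ^ n)

theorem hasSum_reducedPsiTerm {ξ : ℝ} (h0 : 0 < ξ) (h1 : ξ < 1) (j : ℕ) (x : ℂ) :
    HasSum (fun n ↦ reducedPsiTerm z z' ξ j n x) (reducedPsi z z' ξ j x) :=
  (hasSum_regularizedGaussHGFun _ _ _ (by simpa [abs_of_pos h0] using h1)).mul_left _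

theorem differentiable_reducedPsiTerm (ξ : ℝ) (j n : ℕ) :
    Differentiable ℂ (reducedPsiTerm z z' ξ j n) := by
  have h1 : Differentiable ℂ fun x : ℂ ↦ (Gamma (x + j + 1 * 2⁻¹ + n))⁻¹ :=
    differentiable_one_div_Gamma.comp (by fun_prop : Differentiable ℂ fun x : ℂ ↦ x + j + 1 * 2⁻¹ + n)
  have h2 : Differentiable ℂ fun x : ℂ ↦ (ascPochhammer ℂ n).eval (x + z' + 1 * 2⁻¹) :=
    (ascPochhammer ℂ n).differentiable.comp
      (by fun_prop : Differentiable ℂ fun x : ℂ ↦ x + z' + 1 * 2⁻¹)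
  unfold reducedPsiTerm gaussCoeff
  simp only [div_eq_mul_inv, mul_inv]
  fun_prop

/-- The weight contributes at most `(M)_j`, the factor `(j - z)_n` at most `(M + j)_n`, and
`(M)_j (M + j)_n = (M)_{j + n}` balances `Γ(x + 1/2 + j + n)`. This is why `reducedPsi` decays
geometrically in `j`. -/
theorem GammaPositive.reducedPsiTerm_bound (h : GammaPositive z z') {ξ : ℝ} (h0 : 0 < ξ)
    (h1 : ξ < 1) (R : ℝ) : ∃ K ρ : ℝ, 0 ≤ K ∧ 0 ≤ ρ ∧ ρ < 1 ∧ ∀ x : ℂ, ‖x‖ ≤ R → ∀ j n : ℕ,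
      ‖reducedPsiTerm z z' ξ j n x‖ ≤ K * ρ ^ j * ρ ^ n := by
  -- with `η = ξ ^ (-1/4)` the three factors below are `O(η ^ (j + n))`, `O(η ^ n)` and
  -- `ξ ^ (j / 2 + n)`, whose product is `O(η ^ (-j) * η ^ (-2 * n))`
  set η : ℝ := (√(√ξ))⁻¹ with hηdef
  have hq : 0 < √(√ξ) := Real.sqrt_pos.2 (Real.sqrt_pos.2 h0)
  have hq1 : √(√ξ) < 1 := by
    rw [Real.sqrt_lt' one_pos, one_pow, Real.sqrt_lt' one_pos, one_pow]; exact h1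
  have hs : √ξ = √(√ξ) ^ 2 := (Real.sq_sqrt (Real.sqrt_nonneg ξ)).symm
  have hξ : ξ = √(√ξ) ^ 4 := by
    rw [show 4 = 2 * 2 from rfl, pow_mul, ← hs, Real.sq_sqrt h0.le]
  have hη : 1 < η := (one_lt_inv₀ hq).2 hq1
  obtain ⟨M, hMz, hMz', hMR⟩ : ∃ M : ℝ, ‖z‖ ≤ M ∧ ‖z'‖ ≤ M ∧ R + ‖z'‖ + 1 / 2 ≤ M :=
    ⟨max (max ‖z‖ ‖z'‖) (R + ‖z'‖ + 1 / 2), by simp, by simp, by simp⟩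
  have hM : 0 ≤ M := (norm_nonneg _).trans hMz
  obtain ⟨K₁, hK₁, b₁⟩ := ascPochhammer_div_Gamma_bound (R := R + 1 / 2) hM hη
  obtain ⟨K₂, hK₂, b₂⟩ := ascPochhammer_div_factorial_bound hM hη
  have hw0 := (h.gammaWeight_pos 0).le
  refine ⟨gammaWeight z z' 0 * K₁ * K₂, √(√ξ), by positivity, hq.le, hq1, fun x hx j n ↦ ?_⟩
  have hA : ‖(ascPochhammer ℂ n).eval (j - z)‖ ≤ (ascPochhammer ℝ n).eval (M + j) := by
    refine norm_ascPochhammer_le ?_ n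
    have := norm_sub_le (j : ℂ) z
    rw [Complex.norm_natCast] at this
    linarith
  have hD : ‖(ascPochhammer ℂ n).eval (x + z' + 1 / 2)‖ ≤ (ascPochhammer ℝ n).eval M := by
    refine norm_ascPochhammer_le ?_ n
    calc ‖x + z' + 1 / 2‖ ≤ ‖x‖ + ‖z'‖ + ‖(1 / 2 : ℂ)‖ := norm_add₃_le
      _ ≤ M := by norm_num at hMR ⊢; linarith
  have hG := b₁ (x + 1 / 2) (by
    refine (norm_add_le _ _).trans ?_
    norm_num; linarith) (j + n)
  have hF := b₂ n
  have hW := h.gammaWeight_le hMz hMz' j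
  have hWp := (h.gammaWeight_pos j).le
  have hsum : x + j + 1 / 2 + n = x + 1 / 2 + (j + n : ℕ) := by push_cast; ring
  have e1 : ‖reducedPsiTerm z z' ξ j n x‖ = (gammaWeight z z' j *
      ‖(ascPochhammer ℂ n).eval (j - z)‖ * ‖(Gamma (x + 1 / 2 + (j + n : ℕ)))⁻¹‖) *
      (‖(ascPochhammer ℂ n).eval (x + z' + 1 / 2)‖ / n.factorial) * (√ξ ^ j * ξ ^ n) := by
    rw [reducedPsiTerm, gaussCoeff, hsum]
    simp only [norm_mul, norm_div, norm_pow, norm_inv, Complex.norm_natCast, Complex.norm_real,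
      Real.norm_of_nonneg hWp, Real.norm_of_nonneg (Real.sqrt_nonneg ξ), Real.norm_of_nonneg h0.le]
    field_simp
  have hMp := fun n ↦ ascPochhammer_real_eval_nonneg hM n
  have hMp' := ascPochhammer_real_eval_nonneg (M := M + j) (by positivity) n
  rw [e1]
  calc _ ≤ (gammaWeight z z' 0 * (ascPochhammer ℝ j).eval M * (ascPochhammer ℝ n).eval (M + j) *
        ‖(Gamma (x + 1 / 2 + (j + n : ℕ)))⁻¹‖) * ((ascPochhammer ℝ n).eval M / n.factorial) *
        (√ξ ^ j * ξ ^ n) := by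
        have := hMp j
        gcongr
    _ = gammaWeight z z' 0 * ((ascPochhammer ℝ (j + n)).eval M *
        ‖(Gamma (x + 1 / 2 + (j + n : ℕ)))⁻¹‖) * ((ascPochhammer ℝ n).eval M / n.factorial) *
        (√ξ ^ j * ξ ^ n) := by
        rw [ascPochhammer_real_add]; ring
    _ ≤ gammaWeight z z' 0 * (K₁ * η ^ (j + n)) * (K₂ * η ^ n) * (√ξ ^ j * ξ ^ n) := by
        have := div_nonneg (hMp n) n.factorial.cast_nonneg'
        gcongr
    _ = gammaWeight z z' 0 * K₁ * K₂ * ((η * √ξ) ^ j * (η * (η * ξ)) ^ n) := by ring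
    _ ≤ _ := by
        have e2 : η * √ξ = √(√ξ) := by
          rw [hs, hηdef, Real.sqrt_sq hq.le]; field_simp
        have e3 : η * (η * ξ) = √(√ξ) ^ 2 := by
          nth_rw 1 [hξ]; rw [hηdef]; field_simp
        rw [e2, e3, mul_assoc _ (√(√ξ) ^ j)]
        have : (√(√ξ) ^ 2) ^ n ≤ √(√ξ) ^ n :=
          pow_le_pow_left₀ (by positivity) (pow_le_of_le_one hq.le hq1.le two_ne_zero) n
        gcongr

theorem GammaPositive.reducedPsi_bound (h : GammaPositive z z') {ξ : ℝ} (h0 : 0 < ξ)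
    (h1 : ξ < 1) (R : ℝ) : ∃ K ρ : ℝ, 0 ≤ K ∧ 0 ≤ ρ ∧ ρ < 1 ∧ ∀ x : ℂ, ‖x‖ ≤ R → ∀ j : ℕ,
      ‖reducedPsi z z' ξ j x‖ ≤ K * ρ ^ j := by
  obtain ⟨K, ρ, hK, hρ, hρ1, hb⟩ := h.reducedPsiTerm_bound h0 h1 R
  refine ⟨K * (1 - ρ)⁻¹, ρ, mul_nonneg hK (inv_nonneg.2 (by linarith)), hρ, hρ1, fun x hx j ↦ ?_⟩
  rw [← (hasSum_reducedPsiTerm h0 h1 j x).tsum_eq]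
  refine (tsum_of_norm_bounded ((hasSum_geometric_of_lt_one hρ hρ1).mul_left (K * ρ ^ j))
    (hb x hx j)).trans_eq ?_
  ring

theorem GammaPositive.differentiable_reducedPsi (h : GammaPositive z z') {ξ : ℝ} (h0 : 0 < ξ)
    (h1 : ξ < 1) (j : ℕ) : Differentiable ℂ (reducedPsi z z' ξ j) := by
  intro x
  obtain ⟨K, ρ, hK, hρ, hρ1, hb⟩ := h.reducedPsiTerm_bound h0 h1 (‖x‖ + 1)
  have hd : DifferentiableOn ℂ (fun y ↦ ∑' n, reducedPsiTerm z z' ξ j n y)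
      (Metric.ball 0 (‖x‖ + 1)) :=
    differentiableOn_tsum_of_summable_norm
      ((summable_geometric_of_lt_one hρ hρ1).mul_left (K * ρ ^ j))
      (fun n ↦ (differentiable_reducedPsiTerm ξ j n).differentiableOn) Metric.isOpen_ball
      fun n y hy ↦ hb y (mem_ball_zero_iff.1 hy).le j n
  have e : reducedPsi z z' ξ j = fun y ↦ ∑' n, reducedPsiTerm z z' ξ j n y :=
    funext fun y ↦ (hasSum_reducedPsiTerm h0 h1 j y).tsum_eq.symm
  rw [e]
  exact hd.differentiableAt (Metric.isOpen_ball.mem_nhds (by simp))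

/-! ### Joint analyticity of difference quotients -/

/-- The power series at `(c, c)` of the difference quotient of a function with power series `p` at
`c`: its `n`-th term is `p.coeff (n + 1) * ∑ uⁱ vⁿ⁻ⁱ`. -/
def diffQuotSeries (p : FormalMultilinearSeries ℂ ℂ ℂ) :
    FormalMultilinearSeries ℂ (ℂ × ℂ) ℂ := fun n ↦
  p.coeff (n + 1) • ∑ i ∈ Finset.range (n + 1),
    (ContinuousMultilinearMap.mkPiAlgebraFin ℂ n ℂ).compContinuousLinearMap fun k : Fin n ↦
      if (k : ℕ) < i then ContinuousLinearMap.fst ℂ ℂ ℂ else ContinuousLinearMap.snd ℂ ℂ ℂ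

theorem diffQuotSeries_apply (p : FormalMultilinearSeries ℂ ℂ ℂ) (n : ℕ) (w : ℂ × ℂ) :
    (diffQuotSeries p n fun _ ↦ w) =
      p.coeff (n + 1) * ∑ i ∈ Finset.range (n + 1), w.1 ^ i * w.2 ^ (n - i) := by
  simp only [diffQuotSeries, smul_apply, sum_apply,
    smul_eq_mul, ContinuousMultilinearMap.compContinuousLinearMap_apply,
    ContinuousMultilinearMap.mkPiAlgebraFin_apply, List.prod_ofFn]
  congr 1
  refine Finset.sum_congr rfl fun i hi ↦ ?_
  have hi' : i ≤ n := by simpa [Nat.lt_succ_iff] using hi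
  have e : ∀ k : Fin n, (if (k : ℕ) < i then ContinuousLinearMap.fst ℂ ℂ ℂ
      else ContinuousLinearMap.snd ℂ ℂ ℂ) w = if (k : ℕ) < i then w.1 else w.2 := by
    intro k; split_ifs <;> rfl
  simp_rw [e]
  rw [Fin.prod_univ_eq_prod_range (fun k ↦ if k < i then w.1 else w.2) n,
    ← Nat.add_sub_cancel' hi', Finset.prod_range_add, Nat.add_sub_cancel']
  · congr 1
    · rw [Finset.prod_congr rfl fun k hk ↦ if_pos (Finset.mem_range.1 hk)]
      simp
    · simp
  · exact hi'

theorem norm_diffQuotSeries_le (p : FormalMultilinearSeries ℂ ℂ ℂ) (n : ℕ) :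
    ‖diffQuotSeries p n‖ ≤ ‖p (n + 1)‖ * (n + 1) := by
  rw [diffQuotSeries, norm_smul, FormalMultilinearSeries.norm_apply_eq_norm_coef]
  gcongr
  refine (norm_sum_le _ _).trans ?_
  have : ∀ i ∈ Finset.range (n + 1),
      ‖(ContinuousMultilinearMap.mkPiAlgebraFin ℂ n ℂ).compContinuousLinearMap fun k : Fin n ↦
        if (k : ℕ) < i then ContinuousLinearMap.fst ℂ ℂ ℂ else ContinuousLinearMap.snd ℂ ℂ ℂ‖ ≤ 1 := by
    intro i _
    refine (ContinuousMultilinearMap.norm_compContinuousLinearMap_le _ _).trans ?_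
    rw [ContinuousMultilinearMap.norm_mkPiAlgebraFin, one_mul]
    refine Finset.prod_le_one (fun _ _ ↦ norm_nonneg _) fun k _ ↦ ?_
    split_ifs
    · exact ContinuousLinearMap.norm_fst_le ..
    · exact ContinuousLinearMap.norm_snd_le ..
  refine (Finset.sum_le_card_nsmul _ _ 1 this).trans ?_
  simp

/-- The difference quotient of an entire function is jointly analytic at diagonal points; the
division by `w.2 - w.1` is carried out on the power series at `(c, c)`. -/
theorem analyticAt_dslope_diag {f : ℂ → ℂ} {c : ℂ} (hf : Differentiable ℂ f) :
    AnalyticAt ℂ (fun w : ℂ × ℂ ↦ dslope f w.1 w.2) (c, c) := by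
  obtain ⟨p, r, hp⟩ := hf.analyticAt c
  obtain ⟨ρ, hρ0, hρr⟩ := ENNReal.lt_iff_exists_nnreal_btwn.1 hp.r_pos
  have hρ : 0 < ρ := by exact_mod_cast hρ0
  obtain ⟨K, hK, hb⟩ := p.norm_mul_pow_le_of_lt_radius (hρr.trans_le hp.r_le)
  have hrad : ((ρ / 2 : NNReal) : ENNReal) ≤ (diffQuotSeries p).radius := by
    refine FormalMultilinearSeries.le_radius_of_bound _ (K / ρ) fun n ↦ ?_
    have h1 := hb (n + 1)
    have h2 : ((n : ℝ) + 1) ≤ 2 ^ n := by exact_mod_cast Nat.lt_two_pow_self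
    have hρ' : (0 : ℝ) < ρ := hρ
    rw [le_div_iff₀ hρ']
    calc ‖diffQuotSeries p n‖ * ((ρ / 2 : NNReal) : ℝ) ^ n * ρ
        ≤ (‖p (n + 1)‖ * 2 ^ n) * ((ρ / 2 : NNReal) : ℝ) ^ n * ρ := by
          gcongr
          exact (norm_diffQuotSeries_le p n).trans (by gcongr)
      _ = ‖p (n + 1)‖ * ρ ^ (n + 1) := by
          push_cast
          rw [div_pow, pow_succ]
          field_simp
      _ ≤ K := h1
  have hρ2 : (0 : ENNReal) < ((ρ / 2 : NNReal) : ENNReal) := by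
    exact_mod_cast half_pos hρ
  have hq := ((diffQuotSeries p).hasFPowerSeriesOnBall (hρ2.trans_le hrad)).mono hρ2 hrad
  have hin : ∀ w : ℂ × ℂ, w ∈ Metric.eball (0 : ℂ × ℂ) ((ρ / 2 : NNReal) : ENNReal) →
      w.1 ∈ Metric.eball (0 : ℂ) r ∧ w.2 ∈ Metric.eball (0 : ℂ) r := by
    intro w hw
    have h1 : ((ρ / 2 : NNReal) : ENNReal) ≤ r :=
      le_trans (by exact_mod_cast half_le_self hρ.le) hρr.le
    rw [Metric.mem_eball, Prod.edist_eq, max_lt_iff] at hw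
    exact ⟨hw.1.trans_le h1, hw.2.trans_le h1⟩
  have hoff : ∀ w ∈ Metric.eball (0 : ℂ × ℂ) ((ρ / 2 : NNReal) : ENNReal), w.1 ≠ w.2 →
      dslope f (c + w.1) (c + w.2) = (diffQuotSeries p).sum w := by
    intro w hw hne
    obtain ⟨h1, h2⟩ := hin w hw
    have s1 := (hasSum_nat_add_iff' 1).2 (hp.hasSum h1)
    have s2 := (hasSum_nat_add_iff' 1).2 (hp.hasSum h2)
    have s3 := (s1.sub s2).mul_right (w.1 - w.2)⁻¹
    have s4 := hq.hasSum hw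
    rw [zero_add] at s4
    have hne' : w.1 - w.2 ≠ 0 := sub_ne_zero.2 hne
    have hne2 : w.2 - w.1 ≠ 0 := sub_ne_zero.2 hne.symm
    rw [dslope_of_ne _ (by simpa using hne.symm), slope_def_field, add_sub_add_left_eq_sub]
    have e : (f (c + w.2) - f (c + w.1)) / (w.2 - w.1) =
        (f (c + w.1) - ∑ i ∈ Finset.range 1, (p i fun _ ↦ w.1) -
          (f (c + w.2) - ∑ i ∈ Finset.range 1, (p i fun _ ↦ w.2))) * (w.1 - w.2)⁻¹ := by
      rw [← neg_sub w.1 w.2]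
      simp only [FormalMultilinearSeries.apply_eq_prod_smul_coeff, Finset.range_one,
        Finset.sum_singleton, Fin.prod_const, pow_zero]
      field_simp
      ring
    rw [e]
    refine (s3.congr_fun fun n ↦ ?_).unique s4
    have hgeom := (Commute.all w.1 w.2).geom_sum₂_mul (n + 1)
    rw [diffQuotSeries_apply, FormalMultilinearSeries.apply_eq_prod_smul_coeff,
      FormalMultilinearSeries.apply_eq_prod_smul_coeff]
    simp only [Fin.prod_const, smul_eq_mul, Nat.add_sub_cancel] at hgeom ⊢
    rw [← sub_mul, ← hgeom]
    field_simp
  -- on the diagonal both sides are limits of their values at `(u, y)` with `y ≠ u`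
  have hdiag : ∀ w ∈ Metric.eball (0 : ℂ × ℂ) ((ρ / 2 : NNReal) : ENNReal),
      dslope f (c + w.1) (c + w.2) = (diffQuotSeries p).sum w := by
    intro w hw
    rcases ne_or_eq w.1 w.2 with hne | heq
    · exact hoff w hw hne
    obtain ⟨u, v⟩ := w
    obtain rfl : u = v := heq
    have c1 : ContinuousAt (fun y ↦ dslope f (c + u) (c + y)) u :=
      ContinuousAt.comp (g := dslope f (c + u)) (continuousAt_dslope_same.2 hf.differentiableAt)
        (continuousAt_const.add continuousAt_id)
    have c2 : ContinuousAt (fun y ↦ (diffQuotSeries p).sum (u, y)) u :=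
      ContinuousAt.comp (g := (diffQuotSeries p).sum)
        (hq.continuousOn.continuousAt (Metric.isOpen_eball.mem_nhds hw))
        (continuousAt_const.prodMk continuousAt_id)
    refine tendsto_nhds_unique_of_eventuallyEq (l := 𝓝[≠] u) (c1.tendsto.mono_left inf_le_left)
      (c2.tendsto.mono_left inf_le_left) ?_
    have hmem : ∀ᶠ y in 𝓝 u, (u, y) ∈ Metric.eball (0 : ℂ × ℂ) ((ρ / 2 : NNReal) : ENNReal) :=
      (continuousAt_const.prodMk continuousAt_id).eventually_mem (Metric.isOpen_eball.mem_nhds hw)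
    filter_upwards [hmem.filter_mono inf_le_left, self_mem_nhdsWithin] with y hy hne
    exact hoff (u, y) hy (Ne.symm hne)
  have hcomp : AnalyticAt ℂ (fun w : ℂ × ℂ ↦ (diffQuotSeries p).sum (w - (c, c))) (c, c) := by
    refine AnalyticAt.fun_comp (g := (diffQuotSeries p).sum) ?_
      (analyticAt_id.sub analyticAt_const)
    simpa using hq.analyticAt
  refine hcomp.congr ?_
  have hmem : ∀ᶠ w in 𝓝 ((c, c) : ℂ × ℂ),
      w - (c, c) ∈ Metric.eball (0 : ℂ × ℂ) ((ρ / 2 : NNReal) : ENNReal) := by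
    refine (continuous_id.sub continuous_const).continuousAt.eventually_mem ?_
    simpa using Metric.eball_mem_nhds (0 : ℂ × ℂ) hρ2
  filter_upwards [hmem] with w hw
  rw [← hdiag _ hw]
  simp

/-- The difference quotient of an entire function is an entire function of two variables. -/
theorem analyticAt_dslope {f : ℂ → ℂ} (hf : Differentiable ℂ f) (w : ℂ × ℂ) :
    AnalyticAt ℂ (fun w : ℂ × ℂ ↦ dslope f w.1 w.2) w := by
  obtain ⟨a, b⟩ := w
  rcases eq_or_ne a b with rfl | hne
  · exact analyticAt_dslope_diag hf
  have h1 : AnalyticAt ℂ (fun w : ℂ × ℂ ↦ f w.1) (a, b) :=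
    (hf.analyticAt a).fun_comp (f := Prod.fst) analyticAt_fst
  have h2 : AnalyticAt ℂ (fun w : ℂ × ℂ ↦ f w.2) (a, b) :=
    (hf.analyticAt b).fun_comp (f := Prod.snd) analyticAt_snd
  refine ((h2.sub h1).div (analyticAt_snd.sub analyticAt_fst)
    (sub_ne_zero.2 hne.symm)).congr ?_
  filter_upwards [(isOpen_ne_fun continuous_fst continuous_snd).mem_nhds
    (show ((a, b) : ℂ × ℂ) ∈ {w : ℂ × ℂ | w.1 ≠ w.2} from hne)] with w hw
  rw [dslope_of_ne _ (Ne.symm hw), slope_def_field]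
  rfl

/-! ### Christoffel-Darboux summation -/

variable {ξ : ℝ}

/-- The boundary terms of the telescoping (Christoffel-Darboux) sum. -/
def boundaryTerm (z z' : ℂ) (ξ : ℝ) (x y : ℂ) (n : ℕ) : ℂ :=
  √(ξ * shiftProduct z z' n) * (reducedPsi z z' ξ n x * reducedPsi z z' ξ (n + 1) y -
    reducedPsi z z' ξ (n + 1) x * reducedPsi z z' ξ n y)

theorem GammaPositive.summable_reducedPsi (h : GammaPositive z z') (h0 : 0 < ξ) (h1 : ξ < 1)
    (x y : ℂ) :
    Summable fun n : ℕ ↦ reducedPsi z z' ξ (n + 1) x * reducedPsi z z' ξ (n + 1) y := by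
  obtain ⟨K, ρ, hK, hρ, hρ1, hb⟩ := h.reducedPsi_bound h0 h1 (max ‖x‖ ‖y‖)
  refine Summable.of_norm_bounded
    (g := fun n ↦ K * K * ρ ^ n) ((summable_geometric_of_lt_one hρ hρ1).mul_left _) fun n ↦ ?_
  rw [norm_mul]
  have hx := hb x (le_max_left _ _) (n + 1)
  have hy := hb y (le_max_right _ _) (n + 1)
  have hx' : ‖reducedPsi z z' ξ (n + 1) x‖ ≤ K * ρ ^ n := hx.trans (by
    gcongr ?_ * ?_; exact pow_le_pow_of_le_one hρ hρ1.le (by omega))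
  have hy' : ‖reducedPsi z z' ξ (n + 1) y‖ ≤ K := hy.trans (
    mul_le_of_le_one_right hK (pow_le_one₀ hρ hρ1.le))
  calc _ ≤ (K * ρ ^ n) * K := by gcongr
    _ = _ := by ring

theorem GammaPositive.tendsto_boundaryTerm (h : GammaPositive z z') (h0 : 0 < ξ) (h1 : ξ < 1)
    (x y : ℂ) : Tendsto (boundaryTerm z z' ξ x y) atTop (𝓝 0) := by
  obtain ⟨K, ρ, hK, hρ, hρ1, hb⟩ := h.reducedPsi_bound h0 h1 (max ‖x‖ ‖y‖)
  have hx := hb x (le_max_left _ _)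
  have hy := hb y (le_max_right _ _)
  have hle : ∀ w, (∀ j, ‖reducedPsi z z' ξ j w‖ ≤ K * ρ ^ j) → ∀ n,
      ‖reducedPsi z z' ξ (n + 1) w‖ ≤ K := fun w hw n ↦
    (hw (n + 1)).trans (mul_le_of_le_one_right hK (pow_le_one₀ hρ hρ1.le))
  have hsqrt : ∀ n : ℕ, √(ξ * shiftProduct z z' n) ≤ n + (‖z‖ + ‖z'‖) := by
    intro n
    refine Real.sqrt_le_iff.2 ⟨by positivity, ?_⟩
    have h2 := (h.shiftProduct_spec n).1.le
    refine (mul_le_of_le_one_left h2 h1.le).trans ((re_le_norm _).trans ?_)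
    rw [norm_mul, sq]
    have e1 := norm_sub_le (n : ℂ) z
    have e2 := norm_sub_le (n : ℂ) z'
    rw [Complex.norm_natCast] at e1 e2
    exact mul_le_mul (by linarith [norm_nonneg z']) (by linarith [norm_nonneg z]) (norm_nonneg _)
      (by positivity)
  have hlim : Tendsto (fun n : ℕ ↦ 2 * (K * K) * (n * ρ ^ n + (‖z‖ + ‖z'‖) * ρ ^ n)) atTop (𝓝 0) := by
    simpa using ((tendsto_self_mul_const_pow_of_lt_one hρ hρ1).add
      ((tendsto_pow_atTop_nhds_zero_of_lt_one hρ hρ1).const_mul (‖z‖ + ‖z'‖))).const_mul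
        (2 * (K * K))
  refine squeeze_zero_norm (fun n ↦ ?_) hlim
  rw [boundaryTerm, norm_mul, Complex.norm_real, Real.norm_of_nonneg (Real.sqrt_nonneg _)]
  calc _ ≤ (n + (‖z‖ + ‖z'‖)) * ((K * ρ ^ n) * K + K * (K * ρ ^ n)) := by
        refine mul_le_mul (hsqrt n) ((norm_sub_le _ _).trans ?_) (norm_nonneg _) (by positivity)
        rw [norm_mul, norm_mul]
        gcongr
        · exact hx n
        · exact hle y hy n
        · exact hle x hx n
        · exact hy n
    _ = _ := by ring

/-- The summed Christoffel-Darboux identity for the entire functions `reducedPsi`. -/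
theorem GammaPositive.christoffel_darboux (h : GammaPositive z z') (h0 : 0 < ξ) (h1 : ξ < 1)
    (x y : ℂ) :
    (1 - ξ) * (x - y) * ∑' n : ℕ, reducedPsi z z' ξ (n + 1) x * reducedPsi z z' ξ (n + 1) y =
      boundaryTerm z z' ξ x y 0 := by
  have hstep : ∀ n : ℕ, (1 - ξ) * (x - y) * (reducedPsi z z' ξ (n + 1) x *
      reducedPsi z z' ξ (n + 1) y) =
      boundaryTerm z z' ξ x y n - boundaryTerm z z' ξ x y (n + 1) := by
    intro n
    have hx := h.reducedPsi_three_term h0 h1 n x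
    have hy := h.reducedPsi_three_term h0 h1 n y
    simp only [boundaryTerm, add_assoc, one_add_one_eq_two] at hx hy ⊢
    linear_combination reducedPsi z z' ξ (n + 1) y * hx - reducedPsi z z' ξ (n + 1) x * hy
  have hs := ((h.summable_reducedPsi h0 h1 x y).hasSum.mul_left
    ((1 - ξ) * (x - y) : ℂ)).tendsto_sum_nat
  simp_rw [hstep, Finset.sum_range_sub'] at hs
  refine tendsto_nhds_unique hs ?_
  simpa using (h.tendsto_boundaryTerm h0 h1 x y).const_sub (boundaryTerm z z' ξ x y 0)

theorem GammaPositive.differentiable_tsum_reducedPsi (h : GammaPositive z z') (h0 : 0 < ξ)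
    (h1 : ξ < 1) (x : ℂ) : Differentiable ℂ fun y ↦
      ∑' n : ℕ, reducedPsi z z' ξ (n + 1) x * reducedPsi z z' ξ (n + 1) y := by
  intro y
  obtain ⟨K, ρ, hK, hρ, hρ1, hb⟩ := h.reducedPsi_bound h0 h1 (max ‖x‖ (‖y‖ + 1))
  refine (differentiableOn_tsum_of_summable_norm (u := fun n ↦ K * K * ρ ^ n)
    ((summable_geometric_of_lt_one hρ hρ1).mul_left _)
    (fun n ↦ ((h.differentiable_reducedPsi h0 h1 (n + 1)).const_mul _).differentiableOn)
    (Metric.isOpen_ball (x := (0 : ℂ)) (ε := ‖y‖ + 1)) fun n w hw ↦ ?_).differentiableAt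
    (Metric.isOpen_ball.mem_nhds (by simp))
  rw [norm_mul]
  have hx' : ‖reducedPsi z z' ξ (n + 1) x‖ ≤ K :=
    (hb x (le_max_left _ _) (n + 1)).trans (mul_le_of_le_one_right hK (pow_le_one₀ hρ hρ1.le))
  have hw' : ‖reducedPsi z z' ξ (n + 1) w‖ ≤ K * ρ ^ n :=
    (hb w ((mem_ball_zero_iff.1 hw).le.trans (le_max_right _ _)) (n + 1)).trans (by
      gcongr ?_ * ?_; exact pow_le_pow_of_le_one hρ hρ1.le (by omega))
  calc _ ≤ K * (K * ρ ^ n) := by gcongr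
    _ = _ := by ring

/-- The confluent form of the Christoffel-Darboux identity, obtained by differentiating it in `y`
at `y = x`. -/
theorem GammaPositive.christoffel_darboux_diag (h : GammaPositive z z') (h0 : 0 < ξ) (h1 : ξ < 1)
    (x : ℂ) :
    (1 - ξ) * ∑' n : ℕ, reducedPsi z z' ξ (n + 1) x * reducedPsi z z' ξ (n + 1) x =
      √(ξ * shiftProduct z z' 0) * (deriv (reducedPsi z z' ξ 0) x * reducedPsi z z' ξ 1 x -
        deriv (reducedPsi z z' ξ 1) x * reducedPsi z z' ξ 0 x) := by
  have hS := (h.differentiable_tsum_reducedPsi h0 h1 x x).hasDerivAt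
  have hl := (((hasDerivAt_id x).const_sub x).const_mul (1 - ξ : ℂ)).mul hS
  have hr := (((h.differentiable_reducedPsi h0 h1 1 x).hasDerivAt.const_mul
    (reducedPsi z z' ξ 0 x)).sub ((h.differentiable_reducedPsi h0 h1 0 x).hasDerivAt.const_mul
    (reducedPsi z z' ξ 1 x))).const_mul (√(ξ * shiftProduct z z' 0) : ℂ)
  have := hl.unique (hr.congr_of_eventuallyEq (Eventually.of_forall fun y ↦
    h.christoffel_darboux h0 h1 x y))
  simp only [id, sub_self] at this
  linear_combination -this

theorem analyticAt_Gamma {s : ℂ} (hs : Gamma s ≠ 0) : AnalyticAt ℂ Gamma s := by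
  have := (differentiable_one_div_Gamma.analyticAt s).inv (inv_ne_zero hs)
  exact this.congr (Eventually.of_forall fun w ↦ inv_inv (Gamma w))

theorem GammaPositive.analyticAt_commonFactor (h : GammaPositive z z') (h0 : 0 < ξ) {x : ℂ} (hx : x ∈ halfIntegers) : AnalyticAt ℂ (commonFactor z z' ξ) x := by
  obtain ⟨k, rfl⟩ := hx
  obtain ⟨r, hr, e⟩ := h (k + 1)
  have e1 : (k : ℂ) + 1 / 2 + z + 1 / 2 = z + ((k + 1 : ℤ) : ℂ) := by push_cast; ring
  have e2 : (k : ℂ) + 1 / 2 + z' + 1 / 2 = z' + ((k + 1 : ℤ) : ℂ) := by push_cast; ring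
  have hr' : (r : ℂ) ≠ 0 := by exact_mod_cast hr.ne'
  have hne := mul_ne_zero_iff.1 (e ▸ hr')
  have g1 : AnalyticAt ℂ (fun x ↦ Gamma (x + z + 1 / 2)) ((k : ℂ) + 1 / 2) :=
    AnalyticAt.fun_comp (g := Gamma) (by rw [e1]; exact analyticAt_Gamma hne.1)
      ((analyticAt_id.add analyticAt_const).add analyticAt_const)
  have g2 : AnalyticAt ℂ (fun x ↦ Gamma (x + z' + 1 / 2)) ((k : ℂ) + 1 / 2) :=
    AnalyticAt.fun_comp (g := Gamma) (by rw [e2]; exact analyticAt_Gamma hne.2)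
      ((analyticAt_id.add analyticAt_const).add analyticAt_const)
  refine (((g1.mul g2).cpow analyticAt_const ?_).mul
    (analyticAt_const.cpow ?_ ?_)).mul analyticAt_const
  · simp only [Pi.mul_apply]
    rw [e1, e2, e]
    exact ofReal_mem_slitPlane.2 hr
  · exact (analyticAt_id.div analyticAt_const two_ne_zero).sub analyticAt_const
  · exact ofReal_mem_slitPlane.2 h0

theorem GammaPositive.prefactor_eq (h : GammaPositive z z') (h0 : 0 < ξ) :
    prefactor z z' ξ = √(ξ * shiftProduct z z' 0) / (1 - ξ) := by
  have e := (h.shiftProduct_spec 0).2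
  have hp := (h.shiftProduct_spec 0).1
  rw [prefactor, ← ofReal_cpow_half (by positivity)]
  congr 2
  push_cast at e ⊢
  rw [← e]; ring

end DiscreteHypergeometric

end

open DiscreteHypergeometric in
/-- The series defining the kernel converges absolutely; off the diagonal the kernel equals the
integrable expression; `ψ_{±1/2}` are analytic near the half-integer lattice, the integrable
expression extends analytically across the diagonal, and the kernel on the diagonal is the value of
that extension, which is also given by l'Hospital's rule. -/
theorem proposition3p10 (z z' : ℂ) (ξ : ℝ) (hξ0 : 0 < ξ) (hξ1 : ξ < 1)
    (hz : PrincipalSeries z z' ∨ ComplementarySeries z z') :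
    (∀ x ∈ halfIntegers, ∀ y ∈ halfIntegers,
      Summable fun n : ℕ =>
        psi z z' ξ ((n : ℂ) + 1 / 2) x * psi z z' ξ ((n : ℂ) + 1 / 2) y) ∧
    (∀ x ∈ halfIntegers, ∀ y ∈ halfIntegers, x ≠ y →
      kernel z z' ξ x y = prefactor z z' ξ * (numerator z z' ξ x y / (x - y))) ∧
    (∃ U : Set ℂ, IsOpen U ∧ halfIntegers ⊆ U ∧
      AnalyticOnNhd ℂ (psi z z' ξ (1 / 2)) U ∧
      AnalyticOnNhd ℂ (psi z z' ξ (-1 / 2)) U ∧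
      ∃ Q : ℂ × ℂ → ℂ, AnalyticOnNhd ℂ Q (U ×ˢ U) ∧
        (∀ x ∈ U, ∀ y ∈ U, x ≠ y → Q (x, y) = numerator z z' ξ x y / (x - y)) ∧
        ∀ x ∈ halfIntegers, kernel z z' ξ x x = prefactor z z' ξ * Q (x, x)) ∧
    (∀ x ∈ halfIntegers,
      kernel z z' ξ x x = prefactor z z' ξ *
        (deriv (psi z z' ξ (-1 / 2)) x * psi z z' ξ (1 / 2) x -
          deriv (psi z z' ξ (1 / 2)) x * psi z z' ξ (-1 / 2) x)) := by
  have h : GammaPositive z z' := hz.elim (·.gammaPositive) (·.gammaPositive)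
  have hξ : (1 - ξ : ℂ) ≠ 0 := by
    rw [← Complex.ofReal_one, ← Complex.ofReal_sub, Complex.ofReal_ne_zero]; linarith
  have hpsi : ∀ (n : ℕ) (x : ℂ), psi z z' ξ ((n : ℂ) + 1 / 2) x =
      commonFactor z z' ξ x * reducedPsi z z' ξ (n + 1) x := by
    intro n x
    rw [← h.psi_eq hξ0 hξ1]
    congr 1; push_cast; ring
  have hpos : psi z z' ξ (1 / 2) =
      fun x ↦ commonFactor z z' ξ x * reducedPsi z z' ξ 1 x := by
    funext x
    simpa using hpsi 0 x
  have hneg : psi z z' ξ (-1 / 2) =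
      fun x ↦ commonFactor z z' ξ x * reducedPsi z z' ξ 0 x := by
    funext x
    rw [← h.psi_eq hξ0 hξ1]
    congr 1; push_cast; ring
  have hker : ∀ x y, kernel z z' ξ x y = commonFactor z z' ξ x * commonFactor z z' ξ y *
      ∑' n : ℕ, reducedPsi z z' ξ (n + 1) x * reducedPsi z z' ξ (n + 1) y := by
    intro x y
    rw [kernel, ← tsum_mul_left]
    refine tsum_congr fun n ↦ ?_
    rw [hpsi, hpsi]; ring
  have hnum : ∀ x y, numerator z z' ξ x y = commonFactor z z' ξ x * commonFactor z z' ξ y *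
      (reducedPsi z z' ξ 0 x * reducedPsi z z' ξ 1 y -
        reducedPsi z z' ξ 1 x * reducedPsi z z' ξ 0 y) := by
    intro x y
    rw [numerator, hpos, hneg]; ring
  have hd0 := h.differentiable_reducedPsi hξ0 hξ1 0
  have hd1 := h.differentiable_reducedPsi hξ0 hξ1 1
  have hdiag : ∀ x, kernel z z' ξ x x = prefactor z z' ξ * (commonFactor z z' ξ x ^ 2 *
      (deriv (reducedPsi z z' ξ 0) x * reducedPsi z z' ξ 1 x -
        deriv (reducedPsi z z' ξ 1) x * reducedPsi z z' ξ 0 x)) := by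
    intro x
    have hcd := h.christoffel_darboux_diag hξ0 hξ1 x
    rw [hker, h.prefactor_eq hξ0]
    generalize (∑' n : ℕ, reducedPsi z z' ξ (n + 1) x * reducedPsi z z' ξ (n + 1) x) = S at hcd ⊢
    field_simp
    linear_combination commonFactor z z' ξ x ^ 2 * hcd
  refine ⟨fun x _ y _ ↦ ?_, fun x _ y _ hxy ↦ ?_, ?_, fun x hx ↦ ?_⟩
  · refine ((h.summable_reducedPsi hξ0 hξ1 x y).mul_left
      (commonFactor z z' ξ x * commonFactor z z' ξ y)).congr fun n ↦ ?_
    rw [hpsi, hpsi]; ring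
  · have hcd := h.christoffel_darboux hξ0 hξ1 x y
    have hxy' : x - y ≠ 0 := sub_ne_zero.2 hxy
    rw [boundaryTerm] at hcd
    rw [hker, hnum, h.prefactor_eq hξ0]
    field_simp
    linear_combination commonFactor z z' ξ x * commonFactor z z' ξ y * hcd
  · refine ⟨{x | AnalyticAt ℂ (commonFactor z z' ξ) x}, isOpen_analyticAt ℂ _,
      fun x hx ↦ h.analyticAt_commonFactor hξ0 hx, ?_, ?_,
      fun w ↦ commonFactor z z' ξ w.1 * commonFactor z z' ξ w.2 *
        (dslope (reducedPsi z z' ξ 0) w.1 w.2 * reducedPsi z z' ξ 1 w.2 -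
          dslope (reducedPsi z z' ξ 1) w.1 w.2 * reducedPsi z z' ξ 0 w.2), ?_, ?_, ?_⟩
    · rw [hpos]
      exact fun x hx ↦ AnalyticAt.fun_mul hx (hd1.analyticAt x)
    · rw [hneg]
      exact fun x hx ↦ AnalyticAt.fun_mul hx (hd0.analyticAt x)
    · rintro ⟨x, y⟩ ⟨hx, hy⟩
      have hsnd : ∀ {f : ℂ → ℂ}, Differentiable ℂ f →
          AnalyticAt ℂ (fun w : ℂ × ℂ ↦ f w.2) (x, y) := fun hf ↦
        (hf.analyticAt y).fun_comp (f := Prod.snd) analyticAt_snd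
      have a1 : AnalyticAt ℂ (fun w : ℂ × ℂ ↦ commonFactor z z' ξ w.1) (x, y) :=
        AnalyticAt.fun_comp (f := Prod.fst) hx analyticAt_fst
      have a2 : AnalyticAt ℂ (fun w : ℂ × ℂ ↦ commonFactor z z' ξ w.2) (x, y) :=
        AnalyticAt.fun_comp (f := Prod.snd) hy analyticAt_snd
      exact (a1.mul a2).mul (((analyticAt_dslope hd0 _).mul (hsnd hd1)).sub
        ((analyticAt_dslope hd1 _).mul (hsnd hd0)))
    · intro x _ y _ hxy
      have hxy' : x - y ≠ 0 := sub_ne_zero.2 hxy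
      simp only [dslope_of_ne _ hxy.symm, slope_def_field]
      rw [hnum, ← neg_sub x y]
      field_simp
      ring
    · intro x _
      rw [hdiag]
      simp only [dslope_same]
      ring
  · have hc := (h.analyticAt_commonFactor hξ0 hx).differentiableAt
    rw [hdiag, hpos, hneg, deriv_fun_mul hc (hd0 x), deriv_fun_mul hc (hd1 x)]
    ring
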